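/- Let $G(n,m)$ be the uniformly random graph on the vertex set $\{1,\ldots,n\}$ with exactly $m$ edges. There are a sequence $(\delta_k)_k$ of positive reals and a real sequence $(\eta_k)_k$ with $\eta_k\to0$ as $k\to\infty$ such that the following holds. For every real sequence $(\varepsilon_k)_k$ with $\varepsilon_k\to0$ there is $k_0$ such that for every integer $k\ge k_0$ and every real $d\ge 2k\ln k-\ln k-4+\varepsilon_k$, with $m=\lceil dn/2\rceil$, the probability of the following event tends to $1$ as $n\to\infty$ (with $k,d$ fixed): every (proper) $k$-coloring $\sigma$ of $G(n,m)$ has a set $F(\sigma)$ of vertices that is $\delta_k$-frozen in $\sigma$ and satisfies $|F(\sigma)|\ge(1-\eta_k)n$. Here a set $F$ of vertices is $\delta$-frozen in a $k$-coloring $\sigma$ of a graph on $n$ vertices if every $k$-coloring $\tau$ of this graph with $\tau(v)\ne\sigma(v)$ for some $v\in F$ satisfies $|\{v\in F:\sigma(v)\ne\tau(v)\}|\ge\delta n$. -/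

import Mathlib

open Filter Topology

/-- The simple graphs on the vertex set `Fin n` with exactly `m` edges. -/
def graphsWithEdges (n m : ℕ) : Set (SimpleGraph (Fin n)) :=
  {G | G.edgeSet.ncard = m}

/-- The probability that the uniformly random graph `G(n,m)` (all graphs on `n` labelled vertices
with exactly `m` edges being equally likely) has the property `E`. The value is `0` in the
degenerate case `m > n.choose 2`, in which there is no such graph. -/
noncomputable def gnmProb (n m : ℕ) (E : SimpleGraph (Fin n) → Prop) : ℝ :=
  ({G ∈ graphsWithEdges n m | E G}.ncard : ℝ) / ((graphsWithEdges n m).ncard : ℝ)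

/-- For average degree `d` and `m = ⌈d n / 2⌉`, the random graph `G(n,m)` has the property `E`
with high probability as `n → ∞`. -/
def WHP (d : ℝ) (E : (n : ℕ) → SimpleGraph (Fin n) → Prop) : Prop :=
  Tendsto (fun n : ℕ => gnmProb n ⌈d * (n : ℝ) / 2⌉₊ (E n)) atTop (𝓝 1)

/-- A set `F` of vertices is `δ`-frozen in the `k`-coloring `σ` of the graph `G` on `n` vertices
if every `k`-coloring `τ` of `G` that differs from `σ` at some vertex of `F` differs from `σ`
at no fewer than `δ n` vertices of `F`. -/
def IsFrozen {n k : ℕ} {G : SimpleGraph (Fin n)} (δ : ℝ) (σ : G.Coloring (Fin k))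
    (F : Finset (Fin n)) : Prop :=
  ∀ τ : G.Coloring (Fin k), (∃ v ∈ F, τ v ≠ σ v) →
    δ * (n : ℝ) ≤ (({v ∈ F | σ v ≠ τ v} : Finset (Fin n)).card : ℝ)

/-! The proof is a union bound over pairs of a colouring and a recolouring. For average degree at
least 2k ln k - ln k - 5, the expected number of colourings is at most exp(3n/k) up to a factor
independent of n. So any structure attached to a colouring that costs a further factor exp(-4n/k) is
absent with high probability.

The structure to exclude is a closed set of intermediate size: a set S such that each vertex of S
has a second colour all of whose bearers among its neighbours lie in S. The set where two colourings
differ is closed, and closed sets are stable under union. Let g = n/(k√(ln k)). If no closed set has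
all its colour parts below 2g and some part at least g, then the union T of all closed sets with
parts below g again has parts below g (`exists_isFrozen_of_gap`). A colouring that changes a vertex
outside T changes at least 2g vertices of some class, fewer than g of them in T. So the complement
of T is frozen, and T has at most kg = n/√(ln k) vertices.

To exclude the gap, colourings with unequal class sizes are discarded first, since imbalance alone
costs enough. For a balanced colouring, moving a vertex to colour j forbids its edges to the unmoved
part of class j, at a cost of about exp(-d/k) ≤ 3/k². Summed over the k colours this is O(1/k) per
vertex when |S| < n/√k (`sum_recolourWeight_le_of_card_lt`), and a part of size g is then a large
deviation. A weaker weight bound suffices for larger S (`sum_inGap_le`). -/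

/-! ### First moment bound in G(n,m) -/

/-- Falling factorials compare factor by factor: N - M - i ≤ (N - i)(1 - M/N). -/
lemma choose_sub_le (N M m : ℕ) (hM : M ≤ N) (hm : m ≤ N) :
    ((N - M).choose m : ℝ) ≤ (N.choose m : ℝ) * (1 - (M : ℝ) / N) ^ m := by
  have hdesc : ∀ m ≤ N, ((N - M).descFactorial m : ℝ)
      ≤ (N.descFactorial m : ℝ) * (1 - (M : ℝ) / N) ^ m := by
    intro m
    induction m with
    | zero => simp
    | succ i ih =>
      intro hi
      have hN : (0 : ℝ) < N := by exact_mod_cast (by omega : 0 < N)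
      have hMN : (M : ℝ) ≤ N := by exact_mod_cast hM
      have hiN : (i : ℝ) < N := by exact_mod_cast hi
      have hx : 0 ≤ 1 - (M : ℝ) / N := by
        rw [sub_nonneg, div_le_one hN]; exact hMN
      have hfac : ((N - M - i : ℕ) : ℝ) ≤ ((N - i : ℕ) : ℝ) * (1 - (M : ℝ) / N) := by
        rw [Nat.cast_sub (Nat.le_of_succ_le hi)]
        by_cases h : i ≤ N - M
        · rw [Nat.cast_sub h, Nat.cast_sub hM]
          have : (i : ℝ) * (M / N) ≥ 0 := by positivity
          have h2 : (N : ℝ) * (M / N) = M := by field_simp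
          nlinarith
        · rw [Nat.sub_eq_zero_of_le (by omega)]
          simpa using mul_nonneg (sub_nonneg.2 hiN.le) hx
      rw [Nat.descFactorial_succ, Nat.descFactorial_succ, pow_succ]
      push_cast
      calc ((N - M - i : ℕ) : ℝ) * ((N - M).descFactorial i : ℝ)
          ≤ (((N - i : ℕ) : ℝ) * (1 - (M : ℝ) / N)) *
            ((N.descFactorial i : ℝ) * (1 - (M : ℝ) / N) ^ i) := by
            exact mul_le_mul hfac (ih (by omega)) (by positivity) (by positivity)
        _ = _ := by ring
  have h := hdesc m hm
  rw [Nat.descFactorial_eq_factorial_mul_choose, Nat.descFactorial_eq_factorial_mul_choose] at h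
  push_cast at h
  rw [mul_assoc] at h
  exact le_of_mul_le_mul_left h (by positivity)

/-- All pairs of distinct vertices. -/
def allPairs (n : ℕ) : Finset (Sym2 (Fin n)) := {e | ¬ e.IsDiag}

lemma card_allPairs (n : ℕ) : (allPairs n).card = n.choose 2 := by
  have h := Sym2.card_subtype_not_diag (α := Fin n)
  rw [Fintype.card_subtype, Fintype.card_fin] at h
  exact h

lemma ncard_graphs_avoiding (n m : ℕ) (A : Finset (Sym2 (Fin n))) (hA : A ⊆ allPairs n) :
    {G ∈ graphsWithEdges n m | ∀ e ∈ A, e ∉ G.edgeSet}.ncard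
      = (n.choose 2 - A.card).choose m := by
  classical
  rw [← card_allPairs, ← Finset.card_sdiff_of_subset hA, ← Finset.card_powersetCard,
    ← Set.ncard_coe_finset]
  refine Set.ncard_congr (fun G _ => G.edgeFinset) ?_ ?_ ?_
  · rintro G ⟨hG, hGA⟩
    refine Finset.mem_coe.2 (Finset.mem_powersetCard.2 ⟨?_, ?_⟩)
    · intro e he
      rw [SimpleGraph.mem_edgeFinset] at he
      simp only [Finset.mem_sdiff, allPairs, Finset.mem_filter, Finset.mem_univ, true_and]
      exact ⟨G.not_isDiag_of_mem_edgeSet he, fun h => hGA e h he⟩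
    · rw [← hG, ← SimpleGraph.coe_edgeFinset, Set.ncard_coe_finset]
  · intro G H _ _ h
    exact SimpleGraph.edgeFinset_inj.1 h
  · intro s hs
    rw [Finset.mem_coe, Finset.mem_powersetCard] at hs
    have hE : (SimpleGraph.fromEdgeSet (s : Set (Sym2 (Fin n)))).edgeSet = s := by
      rw [SimpleGraph.edgeSet_fromEdgeSet, sdiff_eq_left, Set.disjoint_left]
      intro e he hd
      have := hs.1 he
      simp only [Finset.mem_sdiff, allPairs, Finset.mem_filter, Finset.mem_univ, true_and] at this
      exact this.1 hd
    refine ⟨SimpleGraph.fromEdgeSet (s : Set (Sym2 (Fin n))), ⟨?_, ?_⟩, ?_⟩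
    · rw [graphsWithEdges, Set.mem_ofPred_eq, hE, Set.ncard_coe_finset, hs.2]
    · intro e he heG
      rw [hE] at heG
      exact (Finset.mem_sdiff.1 (hs.1 heG)).2 he
    · rw [← Finset.coe_inj, SimpleGraph.coe_edgeFinset, hE]

lemma ncard_graphsWithEdges (n m : ℕ) :
    (graphsWithEdges n m).ncard = (n.choose 2).choose m := by
  simpa using ncard_graphs_avoiding n m ∅ (by simp)

/-- First moment bound: if the failure of `E` forces one of the sets `A i` of pairs to contain no
edge, then `E` has probability at least one minus the sum of the avoidance probabilities. -/
lemma one_sub_sum_le_gnmProb {n m : ℕ} {ι : Type*} (hm : m ≤ n.choose 2)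
    (E : SimpleGraph (Fin n) → Prop) (I : Finset ι) (A : ι → Finset (Sym2 (Fin n)))
    (hA : ∀ i ∈ I, A i ⊆ allPairs n)
    (hE : ∀ G, ¬ E G → ∃ i ∈ I, ∀ e ∈ A i, e ∉ G.edgeSet) :
    1 - ∑ i ∈ I, (1 - ((A i).card : ℝ) / (n.choose 2 : ℕ)) ^ m ≤ gnmProb n m E := by
  classical
  have hpos : (0 : ℝ) < (n.choose 2).choose m := by exact_mod_cast Nat.choose_pos hm
  have hsub : graphsWithEdges n m ⊆ {G ∈ graphsWithEdges n m | E G} ∪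
      ⋃ i ∈ I, {G ∈ graphsWithEdges n m | ∀ e ∈ A i, e ∉ G.edgeSet} := by
    intro G hG
    by_cases h : E G
    · exact Or.inl ⟨hG, h⟩
    · obtain ⟨i, hi, h⟩ := hE G h
      exact Or.inr (Set.mem_biUnion hi ⟨hG, h⟩)
  have h1 := (Set.ncard_le_ncard hsub (Set.toFinite _)).trans (Set.ncard_union_le _ _)
  have h2 : (⋃ i ∈ I, {G ∈ graphsWithEdges n m | ∀ e ∈ A i, e ∉ G.edgeSet}).ncard ≤
      ∑ i ∈ I, {G ∈ graphsWithEdges n m | ∀ e ∈ A i, e ∉ G.edgeSet}.ncard :=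
    Finset.set_ncard_biUnion_le _ _
  have h3 : ((n.choose 2).choose m : ℝ) ≤ ({G ∈ graphsWithEdges n m | E G}.ncard : ℝ) +
      ∑ i ∈ I, ({G ∈ graphsWithEdges n m | ∀ e ∈ A i, e ∉ G.edgeSet}.ncard : ℝ) := by
    rw [← ncard_graphsWithEdges]
    exact_mod_cast h1.trans (Nat.add_le_add_left h2 _)
  have h4 : ∑ i ∈ I, ({G ∈ graphsWithEdges n m | ∀ e ∈ A i, e ∉ G.edgeSet}.ncard : ℝ) ≤
      ((n.choose 2).choose m : ℝ) * ∑ i ∈ I, (1 - ((A i).card : ℝ) / (n.choose 2 : ℕ)) ^ m := by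
    rw [Finset.mul_sum]
    refine Finset.sum_le_sum fun i hi => ?_
    rw [ncard_graphs_avoiding n m _ (hA i hi)]
    refine choose_sub_le _ _ _ ?_ hm
    rw [← card_allPairs]
    exact Finset.card_le_card (hA i hi)
  rw [gnmProb, ncard_graphsWithEdges, le_div_iff₀ hpos]
  linarith

lemma gnmProb_le_one (n m : ℕ) (E : SimpleGraph (Fin n) → Prop) : gnmProb n m E ≤ 1 := by
  refine div_le_one_of_le₀ ?_ (by positivity)
  exact_mod_cast Set.ncard_le_ncard (Set.sep_subset _ _) (Set.toFinite _)

/-! ### Closed sets, and frozen sets from a gap in their sizes -/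

/-- The vertices of `S` that have colour `j` under `σ`. -/
def colourPart {n k : ℕ} (σ : Fin n → Fin k) (S : Finset (Fin n)) (j : Fin k) : Finset (Fin n) :=
  {v ∈ S | σ v = j}

/-- A set `S` is closed if each of its vertices `v` has a second colour `j` such that `S` contains
all neighbours of `v` with colour `j`. -/
def IsRecolourClosed {n k : ℕ} (G : SimpleGraph (Fin n)) (σ : Fin n → Fin k)
    (S : Finset (Fin n)) : Prop :=
  ∀ v ∈ S, ∃ j, j ≠ σ v ∧ ∀ w, G.Adj v w → σ w = j → w ∈ S

lemma IsRecolourClosed.union {n k : ℕ} {G : SimpleGraph (Fin n)} {σ : Fin n → Fin k}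
    {S T : Finset (Fin n)} (hS : IsRecolourClosed G σ S) (hT : IsRecolourClosed G σ T) :
    IsRecolourClosed G σ (S ∪ T) := by
  intro v hv
  rcases Finset.mem_union.1 hv with h | h
  · obtain ⟨j, hj, hw⟩ := hS v h
    exact ⟨j, hj, fun w hvw hwj => Finset.mem_union_left _ (hw w hvw hwj)⟩
  · obtain ⟨j, hj, hw⟩ := hT v h
    exact ⟨j, hj, fun w hvw hwj => Finset.mem_union_right _ (hw w hvw hwj)⟩

/-- The second colour of v is `τ v`: a neighbour with that colour under σ cannot keep it under τ. -/
lemma isRecolourClosed_ne {n k : ℕ} {G : SimpleGraph (Fin n)} (σ τ : G.Coloring (Fin k)) :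
    IsRecolourClosed G σ {v | σ v ≠ τ v} := by
  intro v hv
  simp only [Finset.mem_filter, Finset.mem_univ, true_and] at hv ⊢
  exact ⟨τ v, hv.symm, fun w hvw hwj h => τ.valid hvw (hwj.symm.trans h)⟩

lemma card_colourPart_union_le {n k : ℕ} (σ : Fin n → Fin k) (S T : Finset (Fin n)) (j : Fin k) :
    (colourPart σ (S ∪ T) j).card ≤ (colourPart σ S j).card + (colourPart σ T j).card := by
  rw [colourPart, Finset.filter_union]
  exact Finset.card_union_le _ _

lemma sum_card_colourPart {n k : ℕ} (σ : Fin n → Fin k) (S : Finset (Fin n)) :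
    ∑ j, (colourPart σ S j).card = S.card :=
  (Finset.card_eq_sum_card_fiberwise (fun _ _ => Finset.mem_coe.2 (Finset.mem_univ _))).symm

/-- A gap in the possible sizes of closed sets yields a frozen set. -/
lemma exists_isFrozen_of_gap {n k : ℕ} {G : SimpleGraph (Fin n)} (σ : G.Coloring (Fin k))
    {g δ : ℝ} (hg : 0 < g) (hδ : δ * n ≤ g)
    (hgap : ∀ S, IsRecolourClosed G σ S → (∀ j, ((colourPart σ S j).card : ℝ) < 2 * g) →
      ∀ i, ((colourPart σ S i).card : ℝ) < g) :
    ∃ F : Finset (Fin n), IsFrozen δ σ F ∧ (n : ℝ) - k * g ≤ (F.card : ℝ) := by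
  classical
  let small : Finset (Fin n) → Prop := fun S =>
    IsRecolourClosed G σ S ∧ ∀ j, ((colourPart σ S j).card : ℝ) < g
  -- Two small sets have a union with parts below 2g, which the gap pushes back below g; by
  -- induction the union T of all small sets is small.
  let T := (Finset.univ.filter small).sup id
  have hT : small T := by
    refine Finset.sup_induction ?_ ?_ ?_
    · exact ⟨fun v hv => by simp at hv, fun j => by simpa [colourPart] using hg⟩
    · rintro S₁ ⟨h1, h1'⟩ S₂ ⟨h2, h2'⟩
      have hu : IsRecolourClosed G σ (S₁ ⊔ S₂) := h1.union h2
      refine ⟨hu, hgap _ hu fun j => ?_⟩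
      have : ((colourPart σ (S₁ ⊔ S₂) j).card : ℝ) ≤
          (colourPart σ S₁ j).card + (colourPart σ S₂ j).card := by
        exact_mod_cast card_colourPart_union_le _ _ _ _
      linarith [h1' j, h2' j]
    · intro S hS
      exact (Finset.mem_filter.1 hS).2
  have hle : ∀ S, small S → S ⊆ T := fun S hS =>
    Finset.le_sup (f := id) (Finset.mem_filter.2 ⟨Finset.mem_univ _, hS⟩)
  refine ⟨Tᶜ, ?_, ?_⟩
  · rintro τ ⟨v, hvT, hv⟩
    refine hδ.trans ?_
    set S : Finset (Fin n) := {v | σ v ≠ τ v} with hSdef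
    have hS := isRecolourClosed_ne σ τ
    rw [← hSdef] at hS
    -- Otherwise the gap would make S small, so S ⊆ T, although v lies in S and not in T.
    have hbig : ∃ j, 2 * g ≤ ((colourPart σ S j).card : ℝ) := by
      by_contra! h
      have hvS : v ∈ S := by simpa [hSdef] using hv.symm
      exact (Finset.mem_compl.1 hvT) (hle S ⟨hS, hgap S hS h⟩ hvS)
    obtain ⟨j, hj⟩ := hbig
    have hsub : colourPart σ S j ⊆ colourPart σ T j ∪ {v ∈ Tᶜ | σ v ≠ τ v} := by
      intro w hw
      simp only [colourPart, hSdef, Finset.mem_filter, Finset.mem_univ, true_and,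
        Finset.mem_union, Finset.mem_compl] at hw ⊢
      tauto
    have h1 : ((colourPart σ S j).card : ℝ) ≤ (colourPart σ T j).card +
        (({v ∈ Tᶜ | σ v ≠ τ v} : Finset (Fin n)).card : ℝ) := by
      exact_mod_cast (Finset.card_le_card hsub).trans (Finset.card_union_le _ _)
    have h2 := hT.2 j
    linarith
  · have h1 : (T.card : ℝ) ≤ k * g := by
      rw [← sum_card_colourPart σ T]
      push_cast
      refine (Finset.sum_le_sum fun j _ => (hT.2 j).le).trans ?_
      simp
    have h2 : T.card + Tᶜ.card = n := by simp
    have h3 : (T.card : ℝ) + Tᶜ.card = n := by exact_mod_cast h2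
    linarith

/-! ### Recolourings and the vertex pairs they forbid -/

/-- The vertices that `c` recolours. -/
def recoloured {n k : ℕ} (σ c : Fin n → Fin k) : Finset (Fin n) := {v | c v ≠ σ v}

/-- One function records both S and a choice of second colours, so the union bound can run over
functions. The map c need not be a proper colouring. -/
lemma IsRecolourClosed.exists_recolouring {n k : ℕ} {G : SimpleGraph (Fin n)} {σ : Fin n → Fin k}
    {S : Finset (Fin n)} (hS : IsRecolourClosed G σ S) :
    ∃ c : Fin n → Fin k, recoloured σ c = S ∧
      ∀ v w, c v ≠ σ v → c w = σ w → σ w = c v → ¬ G.Adj v w := by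
  classical
  choose f hf hw using hS
  let c : Fin n → Fin k := fun v => if h : v ∈ S then f v h else σ v
  have hc : ∀ v, c v ≠ σ v ↔ v ∈ S := by
    intro v
    by_cases h : v ∈ S
    · simp only [c, h, dif_pos, iff_true]; exact hf v h
    · simp [c, h]
  refine ⟨c, ?_, ?_⟩
  · ext v; simp [recoloured, hc]
  · intro v w hv hw' hwv hadj
    have hvS := (hc v).1 hv
    have : w ∈ S := hw v hvS w hadj (by rw [hwv]; simp [c, hvS])
    exact (hc w).2 this hw'

/-- The colour class of `j`. -/
def colourClass {n k : ℕ} (σ : Fin n → Fin k) (j : Fin k) : Finset (Fin n) := {v | σ v = j}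

/-- The pairs of distinct vertices of the same colour. -/
def monoPairs {n k : ℕ} (σ : Fin n → Fin k) : Finset (Sym2 (Fin n)) :=
  Finset.univ.biUnion fun j => (colourClass σ j).offDiag.image Sym2.mk.uncurry

/-- The pairs `(v, w)` such that `v` is recoloured to the colour of `w`, which is not recoloured. -/
def blockedPairs {n k : ℕ} (σ c : Fin n → Fin k) : Finset (Fin n × Fin n) :=
  {p | c p.1 ≠ σ p.1 ∧ c p.2 = σ p.2 ∧ σ p.2 = c p.1}

/-- The pairs of vertices that may not be adjacent if `σ` is proper and the recoloured vertices
form a closed set. -/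
def forbiddenPairs {n k : ℕ} (σ c : Fin n → Fin k) : Finset (Sym2 (Fin n)) :=
  monoPairs σ ∪ (blockedPairs σ c).image Sym2.mk.uncurry

lemma monoPairs_subset {n k : ℕ} (σ : Fin n → Fin k) : monoPairs σ ⊆ allPairs n := by
  intro e he
  simp only [monoPairs, Finset.mem_biUnion, Finset.mem_image, Finset.mem_offDiag] at he
  obtain ⟨j, -, ⟨v, w⟩, ⟨-, -, hvw⟩, rfl⟩ := he
  simpa [allPairs] using hvw

lemma forbiddenPairs_subset {n k : ℕ} (σ c : Fin n → Fin k) :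
    forbiddenPairs σ c ⊆ allPairs n := by
  refine Finset.union_subset (monoPairs_subset σ) ?_
  intro e he
  simp only [Finset.mem_image, blockedPairs, Finset.mem_filter, Finset.mem_univ, true_and] at he
  obtain ⟨⟨v, w⟩, ⟨h1, h2, h3⟩, rfl⟩ := he
  simp only [allPairs, Finset.mem_filter, Finset.mem_univ, true_and, Function.uncurry_apply_pair,
    Sym2.mk_isDiag_iff]
  rintro rfl
  exact h1 h2

lemma card_monoPairs {n k : ℕ} (σ : Fin n → Fin k) :
    (monoPairs σ).card = ∑ j, (colourClass σ j).card.choose 2 := by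
  rw [monoPairs, Finset.card_biUnion]
  · exact Finset.sum_congr rfl fun j _ => Sym2.card_image_offDiag _
  · intro i _ j _ hij
    rw [Function.onFun, Finset.disjoint_left]
    intro e he he'
    simp only [Finset.mem_image, Finset.mem_offDiag, colourClass, Finset.mem_filter,
      Finset.mem_univ, true_and] at he he'
    obtain ⟨⟨v, w⟩, ⟨hv, hw, -⟩, rfl⟩ := he
    obtain ⟨⟨v', w'⟩, ⟨hv', hw', -⟩, he⟩ := he'
    simp only [Function.uncurry_apply_pair, Sym2.eq_iff] at he
    grind

/-- Blocked pairs are bichromatic, hence disjoint from the monochromatic ones, and exactly one end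
of a blocked pair is recoloured, so forgetting the order loses nothing. -/
lemma card_forbiddenPairs {n k : ℕ} (σ c : Fin n → Fin k) :
    (forbiddenPairs σ c).card = (monoPairs σ).card + (blockedPairs σ c).card := by
  rw [forbiddenPairs, Finset.card_union_of_disjoint, Finset.card_image_of_injOn]
  · rintro ⟨v, w⟩ h ⟨v', w'⟩ h' he
    simp only [blockedPairs, Finset.coe_filter, Finset.mem_univ, true_and, Set.mem_ofPred_eq,
      Function.uncurry_apply_pair, Sym2.eq_iff] at h h' he
    grind
  · rw [Finset.disjoint_left]
    intro e he he'
    simp only [monoPairs, blockedPairs, Finset.mem_biUnion, Finset.mem_image, Finset.mem_offDiag,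
      colourClass, Finset.mem_filter, Finset.mem_univ, true_and] at he he'
    obtain ⟨j, ⟨v, w⟩, ⟨hv, hw, -⟩, rfl⟩ := he
    obtain ⟨⟨v', w'⟩, h', he⟩ := he'
    simp only [Function.uncurry_apply_pair, Sym2.eq_iff] at h' he
    grind

/-- Once the recoloured set is fixed, each summand depends on c through `c v` alone; this makes the
sum over c factorise. -/
lemma card_blockedPairs {n k : ℕ} (σ c : Fin n → Fin k) :
    ((blockedPairs σ c).card : ℝ) = ∑ v ∈ recoloured σ c,
      (((colourClass σ (c v)).card : ℝ) - (colourPart σ (recoloured σ c) (c v)).card) := by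
  have h1 : (blockedPairs σ c).card = ∑ v ∈ recoloured σ c,
      (colourClass σ (c v) \ colourPart σ (recoloured σ c) (c v)).card := by
    rw [← Finset.card_sigma]
    refine Finset.card_nbij' (fun p => ⟨p.1, p.2⟩) (fun p => (p.1, p.2)) ?_ ?_ ?_ ?_
    · rintro ⟨v, w⟩ h
      simp [blockedPairs, colourClass, colourPart, recoloured] at h ⊢
      grind
    · rintro ⟨v, w⟩ h
      simp [blockedPairs, colourClass, colourPart, recoloured] at h ⊢
      grind
    · intro p _; rfl
    · intro p _; rfl
  rw [h1]
  push_cast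
  refine Finset.sum_congr rfl fun v _ => ?_
  rw [Finset.card_sdiff_of_subset, Nat.cast_sub]
  · exact Finset.card_le_card (Finset.filter_subset_filter _ (Finset.subset_univ _))
  · exact Finset.filter_subset_filter _ (Finset.subset_univ _)

/-! ### Class imbalance and the avoidance probability -/

/-- The squared distance of the vector of relative class sizes from the uniform one. -/
noncomputable def imbalance {n k : ℕ} (σ : Fin n → Fin k) : ℝ :=
  ∑ j, (((colourClass σ j).card : ℝ) / n - 1 / k) ^ 2

lemma imbalance_nonneg {n k : ℕ} (σ : Fin n → Fin k) : 0 ≤ imbalance σ :=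
  Finset.sum_nonneg fun _ _ => sq_nonneg _

lemma sum_card_colourClass {n k : ℕ} (σ : Fin n → Fin k) :
    ∑ j, ((colourClass σ j).card : ℝ) = n := by
  have := sum_card_colourPart σ Finset.univ
  rw [Finset.card_univ, Fintype.card_fin] at this
  exact_mod_cast this

lemma sum_sq_card_colourClass {n k : ℕ} (hn : 0 < n) (hk : 0 < k) (σ : Fin n → Fin k) :
    ∑ j, ((colourClass σ j).card : ℝ) ^ 2 = (n : ℝ) ^ 2 * (imbalance σ + 1 / k) := by
  have hn' : (n : ℝ) ≠ 0 := by positivity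
  have hk' : (k : ℝ) ≠ 0 := by positivity
  have h : imbalance σ = (∑ j, ((colourClass σ j).card : ℝ) ^ 2) / n ^ 2
      - 2 / (n * k) * (∑ j, ((colourClass σ j).card : ℝ)) + 1 / k := by
    rw [imbalance, Finset.sum_div, Finset.mul_sum, ← Finset.sum_sub_distrib]
    have : (1 / k : ℝ) = ∑ _j : Fin k, (1 / k : ℝ) ^ 2 := by
      simp; field_simp
    rw [this, ← Finset.sum_add_distrib, ← this]
    refine Finset.sum_congr rfl fun j _ => ?_
    field_simp
    ring
  rw [h, sum_card_colourClass]
  field_simp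
  ring

lemma two_mul_card_monoPairs {n k : ℕ} (hn : 0 < n) (hk : 0 < k) (σ : Fin n → Fin k) :
    2 * ((monoPairs σ).card : ℝ) = (n : ℝ) ^ 2 * (imbalance σ + 1 / k) - n := by
  rw [← sum_sq_card_colourClass hn hk, card_monoPairs]
  conv_rhs => rw [← sum_card_colourClass σ]
  push_cast
  rw [Finset.mul_sum, ← Finset.sum_sub_distrib]
  refine Finset.sum_congr rfl fun j _ => ?_
  rw [Nat.cast_choose_two]
  ring

/-- The quadratic term matters: at x = 1/k it contributes about n ln k/(2k) to the exponent, which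
offsets the -ln k in the degree. -/
lemma one_sub_le_exp_neg_add_sq {x : ℝ} (h0 : 0 ≤ x) (h1 : x ≤ 1) :
    1 - x ≤ Real.exp (-(x + x ^ 2 / 2)) := by
  rcases h1.eq_or_lt with rfl | h1
  · simpa using (Real.exp_pos _).le
  have hs := Real.hasSum_pow_div_log_of_abs_lt_one (abs_lt.2 ⟨by linarith, h1⟩)
  have h := sum_le_hasSum (Finset.range 2) (fun i _ => by positivity) hs
  simp only [Finset.sum_range_succ, Finset.range_zero, Finset.sum_empty] at h
  rw [← Real.log_le_iff_le_exp (by linarith)]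
  norm_num at h
  linarith

lemma avoidance_le {n k m : ℕ} (hk : 0 < k) (hkn : k < n) {d : ℝ} (hd : 0 ≤ d)
    (hm : d * n / 2 ≤ m) (σ c : Fin n → Fin k) :
    (1 - ((forbiddenPairs σ c).card : ℝ) / (n.choose 2 : ℕ)) ^ m ≤
      Real.exp (2 * d) * Real.exp (-(d * n / 2) * (1 / k + 1 / (2 * (k : ℝ) ^ 2) + imbalance σ)) *
        Real.exp (-(d / n) * (blockedPairs σ c).card) := by
  have hn : 0 < n := by omega
  have hn1 : (1 : ℝ) < n := by exact_mod_cast (by omega : 1 < n)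
  have hk0 : (0 : ℝ) < k := by exact_mod_cast hk
  have hkn' : (k : ℝ) + 1 ≤ n := by exact_mod_cast hkn
  have hN : ((n.choose 2 : ℕ) : ℝ) = n * (n - 1) / 2 := Nat.cast_choose_two ℝ n
  have hN0 : (0 : ℝ) < (n.choose 2 : ℕ) := by
    rw [hN]; exact div_pos (mul_pos (by linarith) (by linarith)) two_pos
  set X : ℝ := (monoPairs σ).card / (n.choose 2 : ℕ) with hX
  set Y : ℝ := (blockedPairs σ c).card / (n.choose 2 : ℕ) with hY
  have hX0 : 0 ≤ X := by positivity
  have hY0 : 0 ≤ Y := by positivity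
  have hXY : ((forbiddenPairs σ c).card : ℝ) / (n.choose 2 : ℕ) = X + Y := by
    rw [card_forbiddenPairs, hX, hY]; push_cast; ring
  have hXY1 : X + Y ≤ 1 := by
    rw [← hXY, div_le_one hN0, ← card_allPairs]
    exact_mod_cast Finset.card_le_card (forbiddenPairs_subset σ c)
  have hstep : 1 - (X + Y) ≤ Real.exp (-(X + X ^ 2 / 2 + Y)) := by
    have h1 : 1 - (X + Y) ≤ (1 - X) * (1 - Y) := by nlinarith [mul_nonneg hX0 hY0]
    have h2 := one_sub_le_exp_neg_add_sq hX0 (by linarith)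
    have h3 := Real.one_sub_le_exp_neg Y
    calc _ ≤ (1 - X) * (1 - Y) := h1
      _ ≤ Real.exp (-(X + X ^ 2 / 2)) * Real.exp (-Y) :=
        mul_le_mul h2 h3 (by linarith) (Real.exp_pos _).le
      _ = _ := by rw [← Real.exp_add]; ring_nf
  have hD := imbalance_nonneg σ
  have hXlow : 1 / k + imbalance σ - 1 / (n - 1) ≤ X := by
    have h2 := two_mul_card_monoPairs hn hk σ
    have : X = ((n : ℝ) * (imbalance σ + 1 / k) - 1) / (n - 1) := by
      rw [hX, hN, div_div_eq_mul_div, mul_comm, h2]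
      have : (n : ℝ) - 1 ≠ 0 := by linarith
      field_simp
    have h1 : (0 : ℝ) < n - 1 := by linarith
    rw [this, sub_le_iff_le_add, ← add_div, le_div_iff₀ h1]
    have : (0 : ℝ) < 1 / k := by positivity
    nlinarith
  have hfrac : 1 / ((n : ℝ) - 1) ≤ 1 / k := one_div_le_one_div_of_le hk0 (by linarith)
  have hk1 : 1 / (k : ℝ) ≤ 1 := by
    rw [div_le_one hk0]; exact_mod_cast hk
  have hr0 : 0 < 1 / ((n : ℝ) - 1) := one_div_pos.2 (by linarith)
  have hXX : 1 / k + 1 / (2 * (k : ℝ) ^ 2) + imbalance σ - 2 * (1 / (n - 1)) ≤ X + X ^ 2 / 2 := by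
    have e : 1 / (2 * (k : ℝ) ^ 2) = (1 / k) ^ 2 / 2 := by field_simp
    rw [e]
    -- Squaring needs 1/(n - 1) ≤ 1/k, which is where k < n enters.
    have h5 : (1 / (k : ℝ) - 1 / (n - 1)) ^ 2 ≤ X ^ 2 :=
      pow_le_pow_left₀ (by linarith) (by linarith) 2
    nlinarith [mul_le_mul_of_nonneg_right hk1 hr0.le, sq_nonneg (1 / ((n : ℝ) - 1))]
  have hZ0 : 0 ≤ X + X ^ 2 / 2 + Y := by positivity
  have hYlow : d / n * (blockedPairs σ c).card ≤ d * n / 2 * Y := by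
    rw [hY, hN]
    have h1 : (0 : ℝ) < n - 1 := by linarith
    have e : d * n / 2 * (((blockedPairs σ c).card : ℝ) / (n * (n - 1) / 2)) =
      d / (n - 1) * (blockedPairs σ c).card := by field_simp
    rw [e]
    refine mul_le_mul_of_nonneg_right ?_ (by positivity)
    exact div_le_div_of_nonneg_left hd h1 (by linarith)
  -- The finite-size errors 1/(n - 1) cost only the constant factor exp(2d).
  have hcorr : d * n / 2 * (2 * (1 / ((n : ℝ) - 1))) ≤ 2 * d := by
    have h1 : (0 : ℝ) < n - 1 := by linarith
    have e : d * n / 2 * (2 * (1 / ((n : ℝ) - 1))) = d * n / (n - 1) := by field_simp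
    rw [e, div_le_iff₀ h1]
    have : (2 : ℝ) ≤ n := by exact_mod_cast (by omega : 2 ≤ n)
    nlinarith
  have hdn : 0 ≤ d * n / 2 := by positivity
  rw [hXY]
  calc (1 - (X + Y)) ^ m ≤ Real.exp (-(X + X ^ 2 / 2 + Y)) ^ m :=
        pow_le_pow_left₀ (by linarith) hstep m
    _ = Real.exp (-(m * (X + X ^ 2 / 2 + Y))) := by rw [← Real.exp_nat_mul]; ring_nf
    _ ≤ _ := by
        rw [← Real.exp_add, ← Real.exp_add, Real.exp_le_exp]
        have h6 := mul_le_mul_of_nonneg_right hm hZ0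
        have h7 := mul_le_mul_of_nonneg_left hXX hdn
        linarith

/-! ### Weighted sums over recolourings and gap sets -/

/-- The weight of recolouring a vertex of `S` with `j`. -/
noncomputable def recolourWeight {n k : ℕ} (d : ℝ) (σ : Fin n → Fin k) (S : Finset (Fin n))
    (j : Fin k) : ℝ :=
  Real.exp (-(d / n) * ((colourClass σ j).card - (colourPart σ S j).card))

/-- For a fixed recoloured set S, the vertices of S choose colours independently; admitting the old
colour as well only increases the sum. -/
lemma sum_exp_blockedPairs_le {n k : ℕ} (d : ℝ) (σ : Fin n → Fin k) (P : Finset (Fin n) → Prop)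
    [DecidablePred P] :
    ∑ c : Fin n → Fin k with P (recoloured σ c),
        Real.exp (-(d / n) * (blockedPairs σ c).card) ≤
      ∑ S with P S, (∑ j, recolourWeight d σ S j) ^ S.card := by
  rw [← Finset.sum_fiberwise_of_maps_to (g := recoloured σ) (t := Finset.univ.filter P)
    (fun c hc => by simpa using hc)]
  refine Finset.sum_le_sum fun S _ => ?_
  let t : Fin n → Finset (Fin k) := fun v => if v ∈ S then Finset.univ else {σ v}
  let f : Fin n → Fin k → ℝ := fun v j => if v ∈ S then recolourWeight d σ S j else 1
  have hf : ∀ v j, 0 ≤ f v j := by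
    intro v j
    simp only [f]
    split_ifs
    · exact (Real.exp_pos _).le
    · exact zero_le_one
  have hprod : ∏ v, ∑ j ∈ t v, f v j = (∑ j, recolourWeight d σ S j) ^ S.card := by
    rw [← Finset.prod_const, ← Finset.prod_subset (Finset.subset_univ S)]
    · exact Finset.prod_congr rfl fun v hv => by simp [t, f, hv]
    · intro v _ hv
      simp [t, f, hv]
  rw [← hprod, Finset.prod_univ_sum]
  calc _ = ∑ c ∈ (Finset.univ.filter fun c => P (recoloured σ c)).filter
          (fun c => recoloured σ c = S), ∏ v, f v (c v) := by
        refine Finset.sum_congr rfl fun c hc => ?_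
        have hS := (Finset.mem_filter.1 hc).2
        rw [card_blockedPairs, hS, Finset.mul_sum, Real.exp_sum,
          ← Finset.prod_subset (Finset.subset_univ S)]
        · exact Finset.prod_congr rfl fun v hv => by simp [f, hv, recolourWeight]
        · intro v _ hv
          simp [f, hv]
    _ ≤ _ := by
        refine Finset.sum_le_sum_of_subset_of_nonneg ?_
          fun c _ _ => Finset.prod_nonneg fun v _ => hf v _
        intro c hc
        have hS := (Finset.mem_filter.1 hc).2
        rw [Fintype.mem_piFinset]
        intro v
        by_cases hv : v ∈ S
        · simp [t, hv]
        · have : c v = σ v := by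
            rw [← hS] at hv
            simpa [recoloured] using hv
          simp [t, hv, this]

lemma sum_prod_le_exp_sum {ι : Type*} [Fintype ι] (f : ι → ℝ) (hf : ∀ v, 0 ≤ f v) :
    ∑ S : Finset ι, ∏ v ∈ S, f v ≤ Real.exp (∑ v, f v) := by
  classical
  rw [Real.exp_sum, ← Finset.powerset_univ, ← Finset.prod_one_add]
  refine Finset.prod_le_prod (fun v _ => by linarith [hf v]) fun v _ => ?_
  linarith [Real.add_one_le_exp (f v)]

/-- All parts of `S` are smaller than `2 * g`, but not all are smaller than `g`. -/
def InGap {n k : ℕ} (g : ℝ) (σ : Fin n → Fin k) (S : Finset (Fin n)) : Prop :=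
  (∀ j, ((colourPart σ S j).card : ℝ) < 2 * g) ∧ ∃ i, g ≤ ((colourPart σ S i).card : ℝ)

/-- Exponential Markov in two regimes. If |S| < s, the indicator of a part i of size at least g is
at most exp(L(|S_i| - g)); otherwise 1 ≤ exp(|S| - s). Both bounds are products over S, so the sums
over all S factorise. -/
lemma sum_inGap_le {n k : ℕ} (g s q₁ q₂ L : ℝ) (σ : Fin n → Fin k) [DecidablePred (InGap g σ)]
    (Q : Finset (Fin n) → ℝ) (hQ : ∀ S, 0 ≤ Q S) (hq₁ : 0 ≤ q₁) (hq₂ : 0 ≤ q₂) (hL : 0 ≤ L)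
    (h1 : ∀ S, InGap g σ S → (S.card : ℝ) < s → Q S ≤ q₁)
    (h2 : ∀ S, InGap g σ S → Q S ≤ q₂) :
    ∑ S with InGap g σ S, Q S ^ S.card ≤
      (∑ i, Real.exp (q₁ * n + q₁ * Real.exp L * (colourClass σ i).card - g * L)) +
        Real.exp (Real.exp 1 * q₂ * n - s) := by
  classical
  let f : Fin k → Fin n → ℝ := fun i v => q₁ * if σ v = i then Real.exp L else 1
  have hf : ∀ i v, 0 ≤ f i v := fun i v => mul_nonneg hq₁ (by split_ifs <;> positivity)
  have hfS : ∀ i S, ∏ v ∈ S, f i v = q₁ ^ S.card * Real.exp L ^ (colourPart σ S i).card := by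
    intro i S
    simp only [f, Finset.prod_mul_distrib, Finset.prod_const, Finset.prod_ite, colourPart, one_pow,
      mul_one]
  have hfsum : ∀ i, ∑ v, f i v ≤ q₁ * n + q₁ * Real.exp L * (colourClass σ i).card := by
    intro i
    have : ∀ v, f i v ≤ q₁ + q₁ * if σ v = i then Real.exp L else 0 := by
      intro v
      simp only [f]
      split_ifs <;> simp [hq₁]
    refine (Finset.sum_le_sum fun v _ => this v).trans (le_of_eq ?_)
    rw [Finset.sum_add_distrib, ← Finset.mul_sum, ← Finset.sum_filter]
    simp [colourClass]
    ring
  have hpt : ∀ S, InGap g σ S → Q S ^ S.card ≤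
      (∑ i, Real.exp (-(g * L)) * ∏ v ∈ S, f i v) +
        Real.exp (-s) * ∏ v ∈ S, (Real.exp 1 * q₂) := by
    intro S hS
    have hA : 0 ≤ ∑ i, Real.exp (-(g * L)) * ∏ v ∈ S, f i v :=
      Finset.sum_nonneg fun i _ => mul_nonneg (Real.exp_pos _).le
        (Finset.prod_nonneg fun v _ => hf i v)
    have hB : 0 ≤ Real.exp (-s) * ∏ v ∈ S, (Real.exp 1 * q₂) := by positivity
    rcases lt_or_ge (S.card : ℝ) s with hs | hs
    · obtain ⟨i, hi⟩ := hS.2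
      have hle : Q S ^ S.card ≤ Real.exp (-(g * L)) * ∏ v ∈ S, f i v := by
        rw [hfS, mul_left_comm, ← Real.exp_nat_mul, ← Real.exp_add]
        calc Q S ^ S.card ≤ q₁ ^ S.card := pow_le_pow_left₀ (hQ S) (h1 S hS hs) _
          _ = q₁ ^ S.card * 1 := (mul_one _).symm
          _ ≤ _ := by
            refine mul_le_mul_of_nonneg_left (Real.one_le_exp ?_) (by positivity)
            nlinarith
      have := Finset.single_le_sum (f := fun i => Real.exp (-(g * L)) * ∏ v ∈ S, f i v)
        (fun i _ => mul_nonneg (Real.exp_pos _).le (Finset.prod_nonneg fun v _ => hf i v))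
        (Finset.mem_univ i)
      linarith
    · have hle : Q S ^ S.card ≤ Real.exp (-s) * ∏ v ∈ S, (Real.exp 1 * q₂) := by
        rw [Finset.prod_const, mul_pow, ← Real.exp_nat_mul, ← mul_assoc, ← Real.exp_add]
        calc Q S ^ S.card ≤ q₂ ^ S.card := pow_le_pow_left₀ (hQ S) (h2 S hS) _
          _ = 1 * q₂ ^ S.card := (one_mul _).symm
          _ ≤ _ := by
            refine mul_le_mul_of_nonneg_right (Real.one_le_exp ?_) (by positivity)
            linarith
      linarith
  calc _ ≤ ∑ S with InGap g σ S, ((∑ i, Real.exp (-(g * L)) * ∏ v ∈ S, f i v) +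
        Real.exp (-s) * ∏ v ∈ S, (Real.exp 1 * q₂)) :=
        Finset.sum_le_sum fun S hS => hpt S (Finset.mem_filter.1 hS).2
    _ ≤ ∑ S, ((∑ i, Real.exp (-(g * L)) * ∏ v ∈ S, f i v) +
        Real.exp (-s) * ∏ v ∈ S, (Real.exp 1 * q₂)) := by
        refine Finset.sum_le_sum_of_subset_of_nonneg (Finset.filter_subset _ _) fun S _ _ => ?_
        refine add_nonneg (Finset.sum_nonneg fun i _ => mul_nonneg (Real.exp_pos _).le
          (Finset.prod_nonneg fun v _ => hf i v)) (by positivity)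
    _ = (∑ i, Real.exp (-(g * L)) * ∑ S : Finset (Fin n), ∏ v ∈ S, f i v) +
        Real.exp (-s) * ∑ S : Finset (Fin n), ∏ v ∈ S, (Real.exp 1 * q₂) := by
        rw [Finset.sum_add_distrib, Finset.sum_comm, Finset.mul_sum]
        simp only [Finset.mul_sum]
    _ ≤ _ := by
        refine add_le_add (Finset.sum_le_sum fun i _ => ?_) ?_
        · rw [sub_eq_neg_add, Real.exp_add]
          refine mul_le_mul_of_nonneg_left ?_ (Real.exp_pos _).le
          exact (sum_prod_le_exp_sum _ (hf i)).trans (Real.exp_le_exp.2 (hfsum i))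
        · rw [sub_eq_neg_add, Real.exp_add]
          refine mul_le_mul_of_nonneg_left ?_ (Real.exp_pos _).le
          refine (sum_prod_le_exp_sum _ fun _ => by positivity).trans (le_of_eq ?_)
          simp
          ring

/-- Exponents up to 2 cost exp 2 each; a larger one forces a² + b ≥ 1, so the total of a² + b limits
how many there are. -/
lemma sum_exp_add_le {ι : Type*} [Fintype ι] (a b : ι → ℝ) (X A B : ℝ) (hb : ∀ j, 0 ≤ b j)
    (hX : ∀ j, a j + b j ≤ X) (hA : ∑ j, a j ^ 2 ≤ A) (hB : ∑ j, b j ≤ B) :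
    ∑ j, Real.exp (a j + b j) ≤ Fintype.card ι * Real.exp 2 + Real.exp X * (A + B) := by
  have hpt : ∀ j, Real.exp (a j + b j) ≤ Real.exp 2 + Real.exp X * (a j ^ 2 + b j) := by
    intro j
    have h0 : 0 ≤ a j ^ 2 + b j := add_nonneg (sq_nonneg _) (hb j)
    by_cases h : a j + b j ≤ 2
    · have := Real.exp_le_exp.2 h
      have := mul_nonneg (Real.exp_pos X).le h0
      linarith
    · have h1 : 1 ≤ a j ^ 2 + b j := by nlinarith [hb j, sq_nonneg (a j - 1 / 2)]
      have h2 := Real.exp_le_exp.2 (hX j)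
      have h3 := le_mul_of_one_le_right (Real.exp_pos X).le h1
      linarith [Real.exp_pos 2]
  refine (Finset.sum_le_sum fun j _ => hpt j).trans ?_
  rw [Finset.sum_add_distrib, ← Finset.mul_sum, Finset.sum_add_distrib]
  simp only [Finset.sum_const, Finset.card_univ, nsmul_eq_mul]
  have := mul_le_mul_of_nonneg_left (add_le_add hA hB) (Real.exp_pos X).le
  linarith

/-! ### Numerical estimates for large k -/

/-- The square root of `log k`. -/
noncomputable def sqrtLog (k : ℕ) : ℝ := √(Real.log k)

/-- A lower bound on the average degree. -/
noncomputable def baseDegree (k : ℕ) : ℝ := 2 * (k : ℝ) * Real.log k - Real.log k - 5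

lemma natCast_pos_of_sqrtLog {k : ℕ} (h : 60 ≤ sqrtLog k) : 0 < k := by
  rcases Nat.eq_zero_or_pos k with rfl | hk
  · norm_num [sqrtLog] at h
  · exact hk

lemma log_eq_sqrtLog_sq (k : ℕ) : Real.log k = sqrtLog k ^ 2 := by
  rw [sqrtLog, Real.sq_sqrt (Real.log_natCast_nonneg k)]

lemma natCast_eq_exp_sq {k : ℕ} (h : 60 ≤ sqrtLog k) :
    (k : ℝ) = Real.exp (sqrtLog k ^ 2 / 2) ^ 2 := by
  have hk : (0 : ℝ) < k := by exact_mod_cast natCast_pos_of_sqrtLog h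
  rw [← Real.exp_nat_mul]
  calc (k : ℝ) = Real.exp (sqrtLog k ^ 2) := by rw [← log_eq_sqrtLog_sq, Real.exp_log hk]
    _ = _ := by congr 1; push_cast; ring

/-- With l = √(ln k) the right side is √k. The bound 60 on l is what gives 30l ≤ l²/2. -/
lemma exp_mul_sq_le {l : ℝ} (h : 60 ≤ l) :
    126 * Real.exp (11 * l) * l ^ 2 ≤ Real.exp (l ^ 2 / 2) := by
  have h1 : 126 * l ^ 2 ≤ Real.exp (19 * l) := by
    have := Real.quadratic_le_exp_of_nonneg (x := 19 * l) (by linarith)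
    nlinarith
  calc 126 * Real.exp (11 * l) * l ^ 2 = (126 * l ^ 2) * Real.exp (11 * l) := by ring
    _ ≤ Real.exp (19 * l) * Real.exp (11 * l) :=
      mul_le_mul_of_nonneg_right h1 (Real.exp_pos _).le
    _ = Real.exp (30 * l) := by rw [← Real.exp_add]; ring_nf
    _ ≤ _ := Real.exp_le_exp.2 (by nlinarith)

/-- The estimates, valid for large `k`, in terms of `l = sqrtLog k` and `r = √k`. -/
lemma large_estimates {k : ℕ} (h : 60 ≤ sqrtLog k) {l r : ℝ} (hl : l = sqrtLog k)
    (hr : r = Real.exp (l ^ 2 / 2)) :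
    (k : ℝ) = r ^ 2 ∧ 100 ≤ r ∧ l ^ 2 + 5 ≤ r ∧ 126 * Real.exp (11 * l) * l ^ 2 ≤ r ∧
      baseDegree k = 2 * r ^ 2 * l ^ 2 - l ^ 2 - 5 ∧ 8 / 5 * r ^ 2 * l ^ 2 ≤ baseDegree k ∧
      baseDegree k ≤ 2 * r ^ 2 * l ^ 2 := by
  have hl60 : 60 ≤ l := hl ▸ h
  have hk : (k : ℝ) = r ^ 2 := by rw [hr, hl]; exact natCast_eq_exp_sq h
  have h1 : 126 * Real.exp (11 * l) * l ^ 2 ≤ r := by rw [hr]; exact exp_mul_sq_le hl60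
  have h2 : 126 * l ^ 2 ≤ r := by
    refine le_trans ?_ h1
    have := Real.one_le_exp (x := 11 * l) (by linarith)
    nlinarith
  have hd : baseDegree k = 2 * r ^ 2 * l ^ 2 - l ^ 2 - 5 := by
    rw [baseDegree, log_eq_sqrtLog_sq, hk, ← hl]
  have h3 : 100 ≤ r := by nlinarith
  refine ⟨hk, h3, by nlinarith, h1, hd, ?_, ?_⟩
  · rw [hd]
    have : 10000 ≤ r ^ 2 := by nlinarith
    nlinarith
  · rw [hd]; nlinarith

/-- This is the exponential growth rate of the expected number of colourings: the terms in ln k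
cancel to leading order and 5/(2k) remains, up to lower order. -/
lemma log_sub_le {k : ℕ} (h : 60 ≤ sqrtLog k) :
    Real.log k - baseDegree k / 2 * (1 / k + 1 / (2 * (k : ℝ) ^ 2)) ≤ 3 / k := by
  obtain ⟨hk, hr, h2, -, hd, -, -⟩ := large_estimates h rfl rfl
  rw [log_eq_sqrtLog_sq, hd, ← hk]
  have hk0 : (0 : ℝ) < k := by exact_mod_cast natCast_pos_of_sqrtLog h
  set l := sqrtLog k
  set r := Real.exp (l ^ 2 / 2)
  have hlk : l ^ 2 + 5 ≤ k := by rw [hk]; nlinarith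
  have e : l ^ 2 - (2 * (k : ℝ) * l ^ 2 - l ^ 2 - 5) / 2 * (1 / k + 1 / (2 * (k : ℝ) ^ 2)) =
      (5 / 2 + (l ^ 2 + 5) / (4 * k)) / k := by
    field_simp
    ring
  rw [e]
  refine div_le_div_of_nonneg_right ?_ hk0.le
  have : (l ^ 2 + 5) / (4 * k) ≤ 1 / 4 := by
    rw [div_le_div_iff₀ (by positivity) (by norm_num)]
    linarith
  linarith

lemma exp_neg_baseDegree_le {k : ℕ} (h : 60 ≤ sqrtLog k) :
    Real.exp (-(baseDegree k / k)) ≤ 3 / (k : ℝ) ^ 2 := by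
  obtain ⟨hk, hr, h2, -, hd, -, -⟩ := large_estimates h rfl rfl
  have hk0 : (0 : ℝ) < k := by exact_mod_cast natCast_pos_of_sqrtLog h
  have hlk : sqrtLog k ^ 2 + 5 ≤ k := by rw [hk]; nlinarith
  have e : -(baseDegree k / k) = (sqrtLog k ^ 2 + 5) / k - (2 : ℕ) * Real.log k := by
    rw [hd, ← hk, log_eq_sqrtLog_sq]
    field_simp
    push_cast
    ring
  rw [e, Real.exp_sub, Real.exp_nat_mul, Real.exp_log hk0]
  refine div_le_div_of_nonneg_right ?_ (by positivity)
  have h1 : (sqrtLog k ^ 2 + 5) / k ≤ 1 := by rwa [div_le_one hk0]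
  have := Real.exp_le_exp.2 h1
  linarith [Real.exp_one_lt_d9]

/-! ### Recolouring weights for balanced colourings -/

/-- The threshold above which a colouring counts as unbalanced. -/
noncomputable def imbalanceBound (k : ℕ) : ℝ := 10 / ((k : ℝ) ^ 2 * Real.log k)

section Balanced

variable {n k : ℕ} {σ : Fin n → Fin k} {S : Finset (Fin n)}

lemma deviation_sq_sum_le (h : 60 ≤ sqrtLog k) (hσ : imbalance σ < imbalanceBound k) :
    ∑ j, (baseDegree k * (1 / k - (colourClass σ j).card / n)) ^ 2 ≤ 40 * sqrtLog k ^ 2 := by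
  obtain ⟨hk, hr, -, -, -, hd1, hd2⟩ := large_estimates h rfl rfl
  have hk0 : (0 : ℝ) < k := by exact_mod_cast natCast_pos_of_sqrtLog h
  have hd0 : 0 ≤ baseDegree k := le_trans (by positivity) hd1
  have e : ∑ j, (baseDegree k * (1 / k - (colourClass σ j).card / n)) ^ 2 =
      baseDegree k ^ 2 * imbalance σ := by
    rw [imbalance, Finset.mul_sum]
    exact Finset.sum_congr rfl fun j _ => by ring
  rw [e]
  rw [← hk] at hd2
  have hl : 0 < sqrtLog k := by linarith
  calc baseDegree k ^ 2 * imbalance σ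
      ≤ (2 * (k : ℝ) * sqrtLog k ^ 2) ^ 2 * imbalanceBound k :=
        mul_le_mul (pow_le_pow_left₀ hd0 hd2 2) hσ.le (imbalance_nonneg σ) (by positivity)
    _ = _ := by
        rw [imbalanceBound, log_eq_sqrtLog_sq]
        field_simp
        norm_num

lemma colourClass_card_le (h : 60 ≤ sqrtLog k) (hn : 0 < n)
    (hσ : imbalance σ < imbalanceBound k) (j : Fin k) :
    ((colourClass σ j).card : ℝ) ≤ 2 * n / k := by
  have hk0 : (0 : ℝ) < k := by exact_mod_cast natCast_pos_of_sqrtLog h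
  have hn0 : (0 : ℝ) < n := by exact_mod_cast hn
  have h1 : (((colourClass σ j).card : ℝ) / n - 1 / k) ^ 2 ≤ imbalance σ :=
    Finset.single_le_sum (f := fun j => (((colourClass σ j).card : ℝ) / n - 1 / k) ^ 2)
      (fun _ _ => sq_nonneg _) (Finset.mem_univ j)
  have h2 : imbalanceBound k ≤ (1 / (k : ℝ)) ^ 2 := by
    rw [imbalanceBound, log_eq_sqrtLog_sq, one_div, inv_pow, ← one_div,
      div_le_div_iff₀ (by positivity) (by positivity)]
    have h1 : 10 ≤ sqrtLog k ^ 2 := by nlinarith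
    have := mul_le_mul_of_nonneg_left h1 (sq_nonneg (k : ℝ))
    linarith
  have h3 := abs_le_of_sq_le_sq' (h1.trans (hσ.le.trans h2)) (by positivity)
  have h4 : ((colourClass σ j).card : ℝ) / n ≤ 2 / k := by
    have : (2 : ℝ) / k = 1 / k + 1 / k := by ring
    linarith [h3.2]
  rw [div_le_iff₀ hn0] at h4
  calc _ ≤ _ := h4
    _ = _ := by ring

lemma recolourWeight_eq (d : ℝ) (j : Fin k) :
    recolourWeight d σ S j = Real.exp (-(d / k)) *
      Real.exp (d * (1 / k - (colourClass σ j).card / n) + d * ((colourPart σ S j).card / n)) := by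
  rw [recolourWeight, ← Real.exp_add]
  congr 1
  ring

/-- The exponents in `recolourWeight` are small if `S` contains few vertices of each class. -/
lemma exponent_le (h : 60 ≤ sqrtLog k) (hn : 0 < n) (hσ : imbalance σ < imbalanceBound k)
    (hS : ∀ j, ((colourPart σ S j).card : ℝ) < 2 * (n / (sqrtLog k * k))) (j : Fin k) :
    baseDegree k * (1 / k - (colourClass σ j).card / n) +
      baseDegree k * ((colourPart σ S j).card / n) ≤ 11 * sqrtLog k := by
  obtain ⟨hk, hr, -, -, -, hd1, hd2⟩ := large_estimates h rfl rfl
  have hk0 : (0 : ℝ) < k := by exact_mod_cast natCast_pos_of_sqrtLog h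
  have hn0 : (0 : ℝ) < n := by exact_mod_cast hn
  have hl : 0 < sqrtLog k := by linarith
  -- The total 11 is 7 from the class deviations, as 40 ≤ 7², plus 4 from the parts of S, as d is at
  -- most 2k ln k.
  have h1 : (baseDegree k * (1 / k - (colourClass σ j).card / n)) ^ 2 ≤ (7 * sqrtLog k) ^ 2 := by
    refine (Finset.single_le_sum
      (f := fun j => (baseDegree k * (1 / k - (colourClass σ j).card / n)) ^ 2)
      (fun _ _ => sq_nonneg _) (Finset.mem_univ j)).trans ?_
    refine (deviation_sq_sum_le h hσ).trans ?_
    nlinarith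
  have h2 := (abs_le_of_sq_le_sq' h1 (by positivity)).2
  have h3 : baseDegree k * ((colourPart σ S j).card / n) ≤ 4 * sqrtLog k := by
    have h4 : ((colourPart σ S j).card : ℝ) / n ≤ 2 / (sqrtLog k * k) := by
      rw [div_le_iff₀ hn0]
      refine (hS j).le.trans (le_of_eq ?_)
      ring
    rw [← hk] at hd2
    calc _ ≤ (2 * (k : ℝ) * sqrtLog k ^ 2) * (2 / (sqrtLog k * k)) :=
          mul_le_mul hd2 h4 (by positivity) (by positivity)
      _ = _ := by field_simp; norm_num
  linarith

lemma sum_recolourWeight_le (h : 60 ≤ sqrtLog k) (hn : 0 < n)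
    (hσ : imbalance σ < imbalanceBound k)
    (hS : ∀ j, ((colourPart σ S j).card : ℝ) < 2 * (n / (sqrtLog k * k))) :
    ∑ j, recolourWeight (baseDegree k) σ S j ≤ 3 * Real.exp (11 * sqrtLog k) / k := by
  have hk0 : (0 : ℝ) < k := by exact_mod_cast natCast_pos_of_sqrtLog h
  have hpt : ∀ j, recolourWeight (baseDegree k) σ S j ≤
      3 / (k : ℝ) ^ 2 * Real.exp (11 * sqrtLog k) := by
    intro j
    rw [recolourWeight_eq]
    exact mul_le_mul (exp_neg_baseDegree_le h) (Real.exp_le_exp.2 (exponent_le h hn hσ hS j))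
      (Real.exp_pos _).le (by positivity)
  refine (Finset.sum_le_sum fun j _ => hpt j).trans (le_of_eq ?_)
  simp only [Finset.sum_const, Finset.card_univ, Fintype.card_fin, nsmul_eq_mul]
  field_simp

lemma sum_recolourWeight_le_of_card_lt (h : 60 ≤ sqrtLog k) (hn : 0 < n)
    (hσ : imbalance σ < imbalanceBound k)
    (hS : ∀ j, ((colourPart σ S j).card : ℝ) < 2 * (n / (sqrtLog k * k)))
    (hcard : (S.card : ℝ) < n / Real.exp (sqrtLog k ^ 2 / 2)) :
    ∑ j, recolourWeight (baseDegree k) σ S j ≤ 25 / k := by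
  obtain ⟨hk, hr, -, hexp, -, hd1, hd2⟩ := large_estimates h rfl rfl
  have hk0 : (0 : ℝ) < k := by exact_mod_cast natCast_pos_of_sqrtLog h
  have hn0 : (0 : ℝ) < n := by exact_mod_cast hn
  have hd0 : 0 ≤ baseDegree k := le_trans (by positivity) hd1
  have hB : ∑ j, baseDegree k * (((colourPart σ S j).card : ℝ) / n) ≤
      2 * Real.exp (sqrtLog k ^ 2 / 2) * sqrtLog k ^ 2 := by
    have e : ∑ j, baseDegree k * (((colourPart σ S j).card : ℝ) / n) =
        baseDegree k * (S.card / n) := by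
      rw [← Finset.mul_sum, ← Finset.sum_div, ← sum_card_colourPart σ S]
      push_cast
      rfl
    rw [e]
    have h1 : (S.card : ℝ) / n ≤ 1 / Real.exp (sqrtLog k ^ 2 / 2) := by
      rw [div_le_iff₀ hn0]
      refine hcard.le.trans (le_of_eq ?_)
      ring
    refine (mul_le_mul hd2 h1 (by positivity) (by positivity)).trans (le_of_eq ?_)
    field_simp
  have hsum := sum_exp_add_le _ _ _ _ _ (fun j => by positivity) (exponent_le h hn hσ hS)
    (deviation_sq_sum_le h hσ) hB
  simp only [recolourWeight_eq, ← Finset.mul_sum]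
  refine (mul_le_mul (exp_neg_baseDegree_le h) hsum (by positivity) (by positivity)).trans ?_
  rw [Fintype.card_fin]
  set l := sqrtLog k
  set r := Real.exp (l ^ 2 / 2)
  have he2 : Real.exp 2 ≤ 7.9 := by
    have : Real.exp 2 = Real.exp 1 ^ 2 := by rw [← Real.exp_nat_mul]; norm_num
    rw [this]
    have h1 := Real.exp_one_lt_d9
    have h0 := Real.exp_pos 1
    nlinarith
  -- Here 126 = 3(40 + 2): it absorbs both summands, using r ≥ 1 for r = √k.
  have hX : Real.exp (11 * l) * (40 * l ^ 2 + 2 * r * l ^ 2) ≤ k / 3 := by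
    have : 0 ≤ Real.exp (11 * l) * l ^ 2 := by positivity
    rw [hk]
    nlinarith
  rw [div_mul_eq_mul_div, div_le_div_iff₀ (by positivity) hk0]
  nlinarith [mul_le_mul_of_nonneg_left he2 hk0.le]

end Balanced

/-! ### The union bound over colourings and recolourings -/

lemma sum_recolourings_le {n k : ℕ} (h : 60 ≤ sqrtLog k) (hn : 0 < n) (σ : Fin n → Fin k)
    (P : (Fin n → Fin k) → Prop) [DecidablePred P]
    (hP : ∀ c, P c → (imbalanceBound k ≤ imbalance σ ∧ c = σ) ∨
      (imbalance σ < imbalanceBound k ∧ InGap (n / (sqrtLog k * k)) σ (recoloured σ c))) :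
    ∑ c with P c, Real.exp (-(baseDegree k * n / 2) * imbalance σ) *
        Real.exp (-(baseDegree k / n) * (blockedPairs σ c).card) ≤
      (k + 1) * Real.exp (-(4 * n / k)) := by
  classical
  obtain ⟨hk, hr, -, hexp, -, hd1, hd2⟩ := large_estimates h rfl rfl
  have hk0 : (0 : ℝ) < k := by exact_mod_cast natCast_pos_of_sqrtLog h
  have hn0 : (0 : ℝ) < n := by exact_mod_cast hn
  have hd0 : 0 ≤ baseDegree k := le_trans (by positivity) hd1
  have hl : 0 < sqrtLog k := by linarith
  rcases le_or_gt (imbalanceBound k) (imbalance σ) with hσ | hσ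
  · have hsub : Finset.univ.filter P ⊆ {σ} := by
      intro c hc
      rcases hP c (Finset.mem_filter.1 hc).2 with h | h
      · exact Finset.mem_singleton.2 h.2
      · exact absurd h.1 (not_lt.2 hσ)
    refine (Finset.sum_le_sum_of_subset_of_nonneg hsub fun _ _ _ => by positivity).trans ?_
    rw [Finset.sum_singleton]
    -- The constant 10 in the imbalance threshold gives the exponent -8n/k here.
    have h1 : Real.exp (-(baseDegree k * n / 2) * imbalance σ) ≤ Real.exp (-(4 * n / k)) := by
      rw [Real.exp_le_exp, neg_mul, neg_le_neg_iff]
      rw [← hk] at hd1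
      have hi : 0 < imbalanceBound k := by
        rw [imbalanceBound, log_eq_sqrtLog_sq]; positivity
      calc 4 * n / k ≤ 8 / 5 * k * sqrtLog k ^ 2 * n / 2 * imbalanceBound k := by
            rw [imbalanceBound, log_eq_sqrtLog_sq]
            have : 8 / 5 * (k : ℝ) * sqrtLog k ^ 2 * n / 2 * (10 / (k ^ 2 * sqrtLog k ^ 2)) =
              8 * n / k := by field_simp; norm_num
            rw [this]
            gcongr
            norm_num
        _ ≤ baseDegree k * n / 2 * imbalance σ := by gcongr
    have h2 : Real.exp (-(baseDegree k / n) * (blockedPairs σ σ).card) ≤ 1 := by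
      rw [Real.exp_le_one_iff, neg_mul, neg_nonpos]
      positivity
    have h3 := Real.exp_pos (-(4 * (n : ℝ) / k))
    calc _ ≤ Real.exp (-(4 * n / k)) * 1 := mul_le_mul h1 h2 (by positivity) (by positivity)
      _ ≤ _ := by nlinarith
  · have hgap : ∀ c, P c → InGap (n / (sqrtLog k * k)) σ (recoloured σ c) := by
      intro c hc
      rcases hP c hc with h | h
      · exact absurd hσ (not_lt.2 h.1)
      · exact h.2
    have h1 : Real.exp (-(baseDegree k * n / 2) * imbalance σ) ≤ 1 := by
      rw [Real.exp_le_one_iff, neg_mul, neg_nonpos]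
      exact mul_nonneg (by positivity) (imbalance_nonneg σ)
    have hstep : ∑ c with P c, Real.exp (-(baseDegree k * n / 2) * imbalance σ) *
        Real.exp (-(baseDegree k / n) * (blockedPairs σ c).card) ≤
        ∑ c : Fin n → Fin k with InGap (n / (sqrtLog k * k)) σ (recoloured σ c),
          Real.exp (-(baseDegree k / n) * (blockedPairs σ c).card) := by
      refine (Finset.sum_le_sum fun c _ => mul_le_of_le_one_left (Real.exp_pos _).le h1).trans ?_
      refine Finset.sum_le_sum_of_subset_of_nonneg ?_ fun _ _ _ => (Real.exp_pos _).le
      intro c hc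
      exact Finset.mem_filter.2 ⟨Finset.mem_univ _, hgap c (Finset.mem_filter.1 hc).2⟩
    refine hstep.trans ((sum_exp_blockedPairs_le (baseDegree k) σ
      (InGap (n / (sqrtLog k * k)) σ)).trans ?_)
    -- The tilt is e^L = √k: the tilted class then adds at most n/k to the exponent, while gL =
    -- n√(ln k)/(2k) ≥ 30n/k. With 25n/k from the untilted term, -4n/k remains.
    refine (sum_inGap_le (n / (sqrtLog k * k)) (n / Real.exp (sqrtLog k ^ 2 / 2)) (25 / k)
      (3 * Real.exp (11 * sqrtLog k) / k) (sqrtLog k ^ 2 / 2) σ _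
      (fun S => Finset.sum_nonneg fun j _ => (Real.exp_pos _).le) (by positivity) (by positivity)
      (by positivity) (fun S hS hc => sum_recolourWeight_le_of_card_lt h hn hσ hS.1 hc)
      (fun S hS => sum_recolourWeight_le h hn hσ hS.1)).trans ?_
    rw [add_mul, one_mul]
    refine add_le_add ?_ ?_
    · have : ∀ i, Real.exp (25 / k * n + 25 / k * Real.exp (sqrtLog k ^ 2 / 2) *
          (colourClass σ i).card - n / (sqrtLog k * k) * (sqrtLog k ^ 2 / 2)) ≤
          Real.exp (-(4 * n / k)) := by
        intro i
        rw [Real.exp_le_exp]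
        have h2 : 25 / k * Real.exp (sqrtLog k ^ 2 / 2) * (colourClass σ i).card ≤ n / k := by
          calc _ ≤ 25 / k * Real.exp (sqrtLog k ^ 2 / 2) * (2 * n / k) :=
                mul_le_mul_of_nonneg_left (colourClass_card_le h hn hσ i) (by positivity)
            _ = n / k * (50 / Real.exp (sqrtLog k ^ 2 / 2)) := by
                rw [hk]; field_simp; norm_num
            _ ≤ n / k * 1 := by
                refine mul_le_mul_of_nonneg_left ?_ (by positivity)
                rw [div_le_one (by positivity)]
                linarith
            _ = _ := mul_one _
        have h3 : n / (sqrtLog k * k) * (sqrtLog k ^ 2 / 2) = n / k * (sqrtLog k / 2) := by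
          field_simp
        have h4 : n / k * 30 ≤ n / k * (sqrtLog k / 2) :=
          mul_le_mul_of_nonneg_left (by linarith) (by positivity)
        rw [h3]
        have h5 : 25 / (k : ℝ) * n = n / k * 25 := by ring
        have h6 : 4 * (n : ℝ) / k = n / k * 4 := by ring
        rw [h5, h6]
        linarith
      refine (Finset.sum_le_sum fun i _ => this i).trans ?_
      simp
    · rw [Real.exp_le_exp]
      have h2 : n / Real.exp (sqrtLog k ^ 2 / 2) = n / k * Real.exp (sqrtLog k ^ 2 / 2) := by
        rw [hk]; field_simp
      have h3 : Real.exp 1 * (3 * Real.exp (11 * sqrtLog k) / k) * n =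
          n / k * (Real.exp 1 * (3 * Real.exp (11 * sqrtLog k))) := by ring
      have h6 : 4 * (n : ℝ) / k = n / k * 4 := by ring
      rw [h2, h3, h6, ← mul_sub, ← mul_neg]
      refine mul_le_mul_of_nonneg_left ?_ (by positivity)
      have h7 : 3600 ≤ sqrtLog k ^ 2 := by nlinarith
      have h8 : 1 ≤ Real.exp (11 * sqrtLog k) := Real.one_le_exp (by linarith)
      have h9 := Real.exp_one_lt_d9
      have h10 : Real.exp 1 * Real.exp (11 * sqrtLog k) ≤ 3 * Real.exp (11 * sqrtLog k) :=
        mul_le_mul_of_nonneg_right (by linarith) (by linarith)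
      have h11 : 126 * Real.exp (11 * sqrtLog k) * 1 ≤
          126 * Real.exp (11 * sqrtLog k) * sqrtLog k ^ 2 :=
        mul_le_mul_of_nonneg_left (by linarith) (by linarith)
      linarith

lemma forbiddenPairs_not_mem_edgeSet {n k : ℕ} {G : SimpleGraph (Fin n)}
    (σ : G.Coloring (Fin k)) (c : Fin n → Fin k)
    (hc : ∀ v w, c v ≠ σ v → c w = σ w → σ w = c v → ¬ G.Adj v w) :
    ∀ e ∈ forbiddenPairs σ c, e ∉ G.edgeSet := by
  intro e he
  simp only [forbiddenPairs, monoPairs, blockedPairs, Finset.mem_union, Finset.mem_biUnion,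
    Finset.mem_image, Finset.mem_offDiag, colourClass, Finset.mem_filter, Finset.mem_univ,
    true_and] at he
  rcases he with ⟨j, ⟨v, w⟩, ⟨hv, hw, -⟩, rfl⟩ | ⟨⟨v, w⟩, ⟨h1, h2, h3⟩, rfl⟩
  · exact fun hadj => σ.valid hadj (hv.trans hw.symm)
  · exact fun hadj => hc v w h1 h2 h3 hadj

/-- For large `k` all colourings have a large frozen set, except with exponentially small
probability. -/
theorem frozen_probability_ge {n k m : ℕ} (h : 60 ≤ sqrtLog k) (hkn : k < n)
    (hm : baseDegree k * n / 2 ≤ m) (hmn : m ≤ n.choose 2) {δ : ℝ}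
    (hδ : δ * n ≤ n / (sqrtLog k * k)) :
    1 - Real.exp (2 * baseDegree k) * (k + 1) * Real.exp (-(n / k)) ≤
      gnmProb n m fun G => ∀ σ : G.Coloring (Fin k), ∃ F : Finset (Fin n),
        IsFrozen δ σ F ∧ (1 - 1 / sqrtLog k) * (n : ℝ) ≤ (F.card : ℝ) := by
  classical
  obtain ⟨-, -, -, -, -, hd1, -⟩ := large_estimates h rfl rfl
  have hk := natCast_pos_of_sqrtLog h
  have hk0 : (0 : ℝ) < k := by exact_mod_cast hk
  have hn : 0 < n := by omega
  have hn0 : (0 : ℝ) < n := by exact_mod_cast hn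
  have hd0 : 0 ≤ baseDegree k := le_trans (by positivity) hd1
  have hl : 0 < sqrtLog k := by linarith
  set g : ℝ := n / (sqrtLog k * k) with hg
  -- An unbalanced σ is paired only with itself: its monochromatic pairs alone are costly enough,
  -- and no recolouring is needed.
  let R : (Fin n → Fin k) → (Fin n → Fin k) → Prop := fun σ c =>
    (imbalanceBound k ≤ imbalance σ ∧ c = σ) ∨
      (imbalance σ < imbalanceBound k ∧ InGap g σ (recoloured σ c))
  let I : Finset ((Fin n → Fin k) × (Fin n → Fin k)) := {p | R p.1 p.2}
  refine le_trans ?_ (one_sub_sum_le_gnmProb hmn _ I (fun p => forbiddenPairs p.1 p.2)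
    (fun p _ => forbiddenPairs_subset _ _) ?_)
  · rw [sub_le_sub_iff_left]
    set K : ℝ := Real.exp (2 * baseDegree k) *
      Real.exp (-(baseDegree k * n / 2) * (1 / k + 1 / (2 * (k : ℝ) ^ 2))) with hK
    have hK0 : 0 ≤ K := by positivity
    calc _ ≤ ∑ p ∈ I, K * (Real.exp (-(baseDegree k * n / 2) * imbalance p.1) *
            Real.exp (-(baseDegree k / n) * (blockedPairs p.1 p.2).card)) := by
          refine Finset.sum_le_sum fun p _ => (avoidance_le hk hkn hd0 hm p.1 p.2).trans ?_
          rw [mul_add, Real.exp_add, hK]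
          exact le_of_eq (by ring)
      _ = ∑ σ : Fin n → Fin k, K * ∑ c with R σ c,
            (Real.exp (-(baseDegree k * n / 2) * imbalance σ) *
            Real.exp (-(baseDegree k / n) * (blockedPairs σ c).card)) := by
          rw [Finset.sum_filter, Fintype.sum_prod_type]
          refine Finset.sum_congr rfl fun σ _ => ?_
          rw [Finset.mul_sum, Finset.sum_filter]
      _ ≤ ∑ _σ : Fin n → Fin k, K * ((k + 1) * Real.exp (-(4 * n / k))) := by
          refine Finset.sum_le_sum fun σ _ => mul_le_mul_of_nonneg_left ?_ hK0
          exact sum_recolourings_le h hn σ _ fun c hc => hc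
      _ = Real.exp (2 * baseDegree k) * (k + 1) * Real.exp (n * (Real.log k -
            baseDegree k / 2 * (1 / k + 1 / (2 * (k : ℝ) ^ 2))) - 4 * n / k) := by
          have e : Real.exp (n * (Real.log k -
            baseDegree k / 2 * (1 / k + 1 / (2 * (k : ℝ) ^ 2))) - 4 * n / k) =
            (k : ℝ) ^ n * (Real.exp (-(baseDegree k * n / 2) * (1 / k + 1 / (2 * (k : ℝ) ^ 2))) *
              Real.exp (-(4 * n / k))) := by
            have hpow : (k : ℝ) ^ n = Real.exp (n * Real.log k) := by
              rw [Real.exp_nat_mul, Real.exp_log hk0]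
            rw [hpow, ← Real.exp_add, ← Real.exp_add]
            congr 1
            ring
          rw [e, hK]
          simp only [Finset.sum_const, Finset.card_univ, Fintype.card_fun, Fintype.card_fin,
            nsmul_eq_mul]
          push_cast
          ring
      _ ≤ _ := by
          refine mul_le_mul_of_nonneg_left ?_ (by positivity)
          rw [Real.exp_le_exp]
          have h1 := mul_le_mul_of_nonneg_left (log_sub_le h) hn0.le
          have h2 : (n : ℝ) * (3 / k) - 4 * n / k = -(n / k) := by ring
          linarith
  · intro G hG
    push Not at hG
    obtain ⟨σ, hσ⟩ := hG
    rcases le_or_gt (imbalanceBound k) (imbalance σ) with hb | hb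
    · refine ⟨(σ, σ), Finset.mem_filter.2 ⟨Finset.mem_univ _, Or.inl ⟨hb, rfl⟩⟩, ?_⟩
      exact forbiddenPairs_not_mem_edgeSet σ σ fun v w hv => absurd rfl hv
    · have hex : ∃ S, IsRecolourClosed G σ S ∧ InGap g σ S := by
        by_contra! hno
        obtain ⟨F, hF, hcard⟩ := exists_isFrozen_of_gap σ (g := g) (by positivity) hδ
          fun S hS hS2 i => by
            by_contra! hi
            exact hno S hS ⟨hS2, i, hi⟩
        refine (hσ F hF).not_ge (le_trans (le_of_eq ?_) hcard)
        rw [hg]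
        field_simp
      obtain ⟨S, hS, hSg⟩ := hex
      obtain ⟨c, rfl, hc⟩ := hS.exists_recolouring
      exact ⟨(σ, c), Finset.mem_filter.2 ⟨Finset.mem_univ _, Or.inr ⟨hb, hSg⟩⟩,
        forbiddenPairs_not_mem_edgeSet σ c hc⟩

/-! ### Passage to the limit -/

lemma tendsto_sqrtLog : Tendsto sqrtLog atTop atTop :=
  Real.tendsto_sqrt_atTop.comp (Real.tendsto_log_atTop.comp tendsto_natCast_atTop_atTop)

lemma eventually_ceil_le_choose_two (d : ℝ) :
    ∀ᶠ n : ℕ in atTop, ⌈d * (n : ℝ) / 2⌉₊ ≤ n.choose 2 := by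
  have h1 : ∀ᶠ n : ℕ in atTop, d + 1 ≤ (n : ℝ) :=
    tendsto_natCast_atTop_atTop.eventually_ge_atTop _
  filter_upwards [h1] with n hn
  rw [Nat.ceil_le, Nat.cast_choose_two]
  nlinarith [Nat.cast_nonneg (α := ℝ) n]

theorem corollary2 :
    ∃ δ η : ℕ → ℝ, (∀ k, 0 < δ k) ∧ Tendsto η atTop (𝓝 0) ∧
      ∀ ε : ℕ → ℝ, Tendsto ε atTop (𝓝 0) →
        ∃ k₀ : ℕ, ∀ k : ℕ, k₀ ≤ k → ∀ d : ℝ,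
          2 * (k : ℝ) * Real.log k - Real.log k - 4 + ε k ≤ d →
            WHP d fun n G => ∀ σ : G.Coloring (Fin k), ∃ F : Finset (Fin n),
              IsFrozen (δ k) σ F ∧ (1 - η k) * (n : ℝ) ≤ (F.card : ℝ) := by
  -- The added ones keep δ positive for k = 0 and k = 1, where `sqrtLog` vanishes.
  refine ⟨fun k => 1 / ((sqrtLog k + 1) * (k + 1)), fun k => 1 / sqrtLog k, ?_, ?_, ?_⟩
  · intro k
    have : 0 ≤ sqrtLog k := Real.sqrt_nonneg _
    positivity
  · exact tendsto_sqrtLog.const_div_atTop 1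
  · intro ε hε
    have hev : ∀ᶠ k : ℕ in atTop, -1 < ε k ∧ 60 ≤ sqrtLog k :=
      (hε.eventually (lt_mem_nhds (by norm_num))).and (tendsto_sqrtLog.eventually_ge_atTop 60)
    obtain ⟨k₀, hk₀⟩ := eventually_atTop.1 hev
    refine ⟨k₀, fun k hk d hd => ?_⟩
    obtain ⟨hεk, h⟩ := hk₀ k hk
    -- The constant 5 in place of 4 absorbs every ε > -1.
    have hd' : baseDegree k ≤ d := by rw [baseDegree]; linarith
    have hk0 : (0 : ℝ) < k := by exact_mod_cast natCast_pos_of_sqrtLog h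
    have hlim : Tendsto (fun n : ℕ => 1 - Real.exp (2 * baseDegree k) * (k + 1) *
        Real.exp (-((n : ℝ) / k))) atTop (𝓝 1) := by
      have h1 : Tendsto (fun n : ℕ => Real.exp (-((n : ℝ) / k))) atTop (𝓝 0) :=
        Real.tendsto_exp_neg_atTop_nhds_zero.comp
          (tendsto_natCast_atTop_atTop.atTop_div_const hk0)
      simpa using (h1.const_mul (Real.exp (2 * baseDegree k) * (k + 1))).const_sub 1
    refine tendsto_of_tendsto_of_tendsto_of_le_of_le' hlim tendsto_const_nhds ?_
      (Eventually.of_forall fun n => gnmProb_le_one _ _ _)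
    filter_upwards [eventually_gt_atTop k, eventually_ceil_le_choose_two d] with n hkn hmn
    refine frozen_probability_ge h hkn (le_trans ?_ (Nat.le_ceil _)) hmn ?_
    · gcongr
    · rw [one_div_mul_eq_div]
      gcongr <;> linarith
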